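/- **Definitions.** A *convex set* is a set $X$ with an operation $(x_1,\dots,x_n)\mapsto\sum_i r_i\cdot x_i$ for every finite tuple of non-negative reals $r_1,\dots,r_n$ with $\sum_i r_i=1$, such that $1\cdot x=x$, point masses act as projections, and $\sum_i r_i\cdot(\sum_j s_{ij}\cdot x_j)=\sum_j(\sum_i r_is_{ij})\cdot x_j$; an *affine map* is a map that preserves these operations. A *Kegelspitze* is a convex set $X$ which is also a dcpo (a partially ordered set in which all nonempty directed subsets have suprema) with a least element $\perp$, such that all operations $X^n\to X$ above are Scott-continuous and the scalar multiplication $[0,1]\times X\to X$, $(\lambda,x)\mapsto\lambda\cdot x+(1-\lambda)\cdot\perp$, is Scott-continuous in both arguments. $\mathbf{KS}$ is the category of Kegelspitzen and affine Scott-continuous maps $f$ that are strict ($f(\perp)=\perp$). With the pointwise order on its hom-sets, $\mathbf{KS}$ is enriched over the category $\mathbf{Dcpo}_{\perp !}$ of dcpos with a least element and strict Scott-continuous maps: hom-sets are dcpos with a least element, and composition is strict and Scott-continuous in each argument. The category $|\mathbf{KS}|=\mathbf{KS}^{\mathrm{op}}\times\mathbf{KS}$ is likewise enriched over $\mathbf{Dcpo}_{\perp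 !}$, with $$|\mathbf{KS}|\big((A,B),(A',B')\big)=\mathbf{KS}(A',A)\times\mathbf{KS}(B,B')$$ ordered componentwise. An endofunctor $F$ of a $\mathbf{Dcpo}_{\perp !}$-enriched category $\mathbf C$ is *locally continuous* if every map $F_{X,Y}:\mathbf C(X,Y)\to\mathbf C(FX,FY)$ is Scott-continuous. $\mathbf C$ is *algebraically compact* for a class $\mathcal L$ of endofunctors if every $F\in\mathcal L$ has a fixpoint, i.e. an object $\mu F$ with an isomorphism $e:F(\mu F)\to\mu F$, such that $(\mu F,e)$ is an initial $F$-algebra and $(\mu F,e^{-1})$ is a final $F$-coalgebra. **Corollary.** The category $|\mathbf{KS}|=\mathbf{KS}^{\mathrm{op}}\times\mathbf{KS}$ is algebraically compact for locally continuous endofunctors. -/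

import Mathlib

open CategoryTheory Opposite Convexity

universe u v w

noncomputable section

namespace Kegelspitzen

/-! ### Kegelspitzen -/

/-- Scalar multiplication `r · x = x ⊕_r ⊥ = r x + (1 - r) ⊥` of a convex set with a least element,
for `r` in the real unit interval. -/
def scale {X : Type u} [CompletePartialOrder X] [ConvexSpace ℝ X] (r : unitInterval) (x : X) : X :=
  convexCombPair (r : ℝ) (1 - (r : ℝ)) r.2.1 (sub_nonneg.2 r.2.2) (add_sub_cancel _ _) x ⊥

/-- A Kegelspitze: a dcpo with a least element (Mathlib's `CompletePartialOrder`) carrying a convex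
structure (Mathlib's `ConvexSpace ℝ`) such that every `n`-ary convex combination operation
`Xⁿ → X` is Scott-continuous, and such that the scalar multiplication `[0,1] × X → X`, with the
least element as zero, is Scott-continuous in both arguments. -/
class IsKegelspitze (X : Type u) [CompletePartialOrder X] [ConvexSpace ℝ X] : Prop where
  scottContinuous_iConvexComb (n : ℕ) (r : StdSimplex ℝ (Fin n)) :
    ScottContinuous fun x : Fin n → X => r.iConvexComb x
  scottContinuous_scale_left (x : X) : ScottContinuous fun r : unitInterval => scale r x
  scottContinuous_scale_right (r : unitInterval) : ScottContinuous fun x : X => scale r x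

/-- Objects of the category of Kegelspitzen. -/
structure KS : Type (u + 1) where
  carrier : Type u
  [dcpo : CompletePartialOrder carrier]
  [convex : ConvexSpace ℝ carrier]
  [isKegelspitze : IsKegelspitze carrier]

namespace KS

instance : CoeSort KS.{u} (Type u) := ⟨KS.carrier⟩

attribute [instance] KS.dcpo KS.convex KS.isKegelspitze

/-- Homomorphisms of Kegelspitzen: affine strict Scott-continuous maps. -/
@[ext]
structure Hom (X Y : KS.{u}) : Type u where
  toFun : X → Y
  affine : IsAffineMap ℝ toFun
  strict : toFun ⊥ = ⊥
  scottContinuous : ScottContinuous toFun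

/-- The category `KS` of Kegelspitzen and affine strict Scott-continuous maps. -/
instance : Category.{u} KS.{u} where
  Hom X Y := Hom X Y
  id X := ⟨id, IsAffineMap.id, rfl, ScottContinuous.id⟩
  comp f g := ⟨g.toFun ∘ f.toFun, g.affine.comp f.affine,
    (congrArg g.toFun f.strict).trans g.strict, f.scottContinuous.comp g.scottContinuous⟩

@[ext]
theorem hom_ext {X Y : KS.{u}} {f g : X ⟶ Y} (h : ∀ x, f.toFun x = g.toFun x) : f = g :=
  Hom.ext (funext h)

/-- Homomorphisms are ordered pointwise. -/
instance (X Y : KS.{u}) : PartialOrder (X ⟶ Y) :=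
  PartialOrder.lift (fun f : X ⟶ Y => f.toFun) fun _ _ h => Hom.ext h

theorem hom_le_iff {X Y : KS.{u}} {f g : X ⟶ Y} : f ≤ g ↔ ∀ x, f.toFun x ≤ g.toFun x :=
  Iff.rfl

/-- The constant homomorphism with value `⊥`. -/
instance (X Y : KS.{u}) : OrderBot (X ⟶ Y) where
  bot := ⟨fun _ => ⊥, IsAffineMap.const ⊥, rfl, ScottContinuous.const ⊥⟩
  bot_le _ := hom_le_iff.2 fun _ => bot_le

theorem bot_apply {X Y : KS.{u}} (x : X) : (⊥ : X ⟶ Y).toFun x = ⊥ := rfl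

theorem exists_fin_simplex {X : Type u} (s : StdSimplex ℝ X) :
    ∃ (n : ℕ) (t : StdSimplex ℝ (Fin n)) (g : Fin n → X), s = t.map g := by
  classical
  let e := s.weights.support.equivFin
  let g : Fin s.weights.support.card → X := fun i => (e.symm i : X)
  have hg : Function.Injective g := Subtype.val_injective.comp e.symm.injective
  have hr : (s.weights.support : Set X) ⊆ Set.range g := fun x hx =>
    ⟨e ⟨x, hx⟩, by simp [g]⟩
  have hm := Finsupp.mapDomain_comapDomain g hg s.weights hr
  refine ⟨_, ⟨s.weights.comapDomain g hg.injOn, fun i => s.nonneg (g i), ?_⟩, g, ?_⟩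
  · have h1 := s.total
    rwa [← hm, Finsupp.sum_mapDomain_index (fun _ => rfl) (fun _ _ _ => rfl)] at h1
  · ext1
    exact hm.symm

/-- Nonempty directed sets of homomorphisms have least upper bounds, computed pointwise. -/
theorem exists_isLUB_hom {X Y : KS.{u}} {S : Set (X ⟶ Y)} (hne : S.Nonempty)
    (hS : DirectedOn (· ≤ ·) S) :
    ∃ h : X ⟶ Y, IsLUB S h ∧ ∀ x, IsLUB ((fun f : X ⟶ Y => f.toFun x) '' S) (h.toFun x) := by
  have hd (x : X) : DirectedOn (· ≤ ·) ((fun f : X ⟶ Y => f.toFun x) '' S) := by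
    rintro _ ⟨f, hf, rfl⟩ _ ⟨g, hg, rfl⟩
    obtain ⟨k, hk, hfk, hgk⟩ := hS f hf g hg
    exact ⟨_, ⟨k, hk, rfl⟩, hfk x, hgk x⟩
  let h₀ : X → Y := fun x => sSup ((fun f : X ⟶ Y => f.toFun x) '' S)
  have hl (x : X) : IsLUB ((fun f : X ⟶ Y => f.toFun x) '' S) (h₀ x) := (hd x).isLUB_sSup
  have hsc : ScottContinuous h₀ := by
    intro D hDne hD a ha
    refine ⟨?_, fun b hb => (hl a).2 ?_⟩
    · rintro _ ⟨d, hdD, rfl⟩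
      refine (hl d).2 ?_
      rintro _ ⟨f, hf, rfl⟩
      exact (f.scottContinuous.monotone (ha.1 hdD)).trans ((hl a).1 ⟨f, hf, rfl⟩)
    · rintro _ ⟨f, hf, rfl⟩
      refine (f.scottContinuous hDne hD ha).2 ?_
      rintro _ ⟨d, hdD, rfl⟩
      exact ((hl d).1 ⟨f, hf, rfl⟩).trans (hb ⟨d, hdD, rfl⟩)
  have hstr : h₀ ⊥ = ⊥ := by
    refine le_bot_iff.1 ((hl ⊥).2 ?_)
    rintro _ ⟨f, _, rfl⟩
    exact f.strict.le
  have haff : IsAffineMap ℝ h₀ := by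
    refine ⟨fun s => ?_⟩
    obtain ⟨n, t, g, rfl⟩ := exists_fin_simplex s
    rw [StdSimplex.map_map]
    change h₀ (t.iConvexComb g) = t.iConvexComb fun i => h₀ (g i)
    refine (hl _).unique ?_
    have key : IsLUB ((fun f : X ⟶ Y => fun i => f.toFun (g i)) '' S) (fun i => h₀ (g i)) := by
      rw [isLUB_pi]
      intro i
      rw [Set.image_image]
      exact hl (g i)
    have hdir : DirectedOn (· ≤ ·) ((fun f : X ⟶ Y => fun i => f.toFun (g i)) '' S) := by
      rintro _ ⟨f, hf, rfl⟩ _ ⟨k, hk, rfl⟩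
      obtain ⟨m, hm, hfm, hkm⟩ := hS f hf k hk
      exact ⟨_, ⟨m, hm, rfl⟩, fun i => hfm (g i), fun i => hkm (g i)⟩
    have := IsKegelspitze.scottContinuous_iConvexComb n t (hne.image _) hdir key
    rw [Set.image_image] at this
    have he : (fun f : X ⟶ Y => f.toFun (t.iConvexComb g)) =
        fun f => t.iConvexComb fun i => f.toFun (g i) :=
      funext fun f => f.affine.map_iConvexComb t g
    rw [he]
    exact this
  exact ⟨⟨h₀, haff, hstr, hsc⟩, ⟨fun f hf x => (hl x).1 ⟨f, hf, rfl⟩, fun k hk x => (hl x).2 (by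
    rintro _ ⟨f, hf, rfl⟩
    exact hk hf x)⟩, hl⟩

end KS

/-! ### Categories enriched over pointed dcpos -/

/-- A `Dcpo_{⊥!}`-enriched category: hom-sets are dcpos with a least element, and composition is
strict and Scott-continuous in each argument. -/
class DcpoCategory (C : Type u) [Category.{v} C] where
  homDcpo (X Y : C) : CompletePartialOrder (X ⟶ Y)
  scottContinuous_precomp {X Y : C} (f : X ⟶ Y) (Z : C) :
    ScottContinuous fun g : Y ⟶ Z => f ≫ g
  scottContinuous_postcomp (X : C) {Y Z : C} (g : Y ⟶ Z) :
    ScottContinuous fun f : X ⟶ Y => f ≫ g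
  comp_bot {X Y : C} (f : X ⟶ Y) (Z : C) : f ≫ (⊥ : Y ⟶ Z) = ⊥
  bot_comp (X : C) {Y Z : C} (g : Y ⟶ Z) : (⊥ : X ⟶ Y) ≫ g = ⊥

attribute [reducible, instance] DcpoCategory.homDcpo

/-- A partial order with a least element in which every nonempty directed set has a least upper
bound is a `CompletePartialOrder`; the order and the least element are unchanged, and the value of
`sSup` on sets that are not directed is irrelevant. -/
@[reducible]
def completePartialOrderOfExists (α : Type u) [PartialOrder α] [OrderBot α]
    (h : ∀ S : Set α, S.Nonempty → DirectedOn (· ≤ ·) S → ∃ a, IsLUB S a) :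
    CompletePartialOrder α :=
  open scoped Classical in
  { sSup := fun S => if hS : ∃ a, IsLUB S a then hS.choose else ⊥
    lubOfDirected := fun S hS => by
      have hex : ∃ a, IsLUB S a := by
        rcases S.eq_empty_or_nonempty with rfl | hne
        · exact ⟨⊥, isLUB_empty⟩
        · exact h S hne hS
      simpa only [dif_pos hex] using hex.choose_spec }

/-- `KS` with the pointwise order on homomorphisms. -/
instance : DcpoCategory KS.{u} where
  homDcpo X Y := completePartialOrderOfExists (X ⟶ Y) fun _ hne hS =>
    (KS.exists_isLUB_hom hne hS).imp fun _ h => h.1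
  scottContinuous_precomp {X Y} f Z S hne hS a ha := by
    obtain ⟨k, hk, hkx⟩ := KS.exists_isLUB_hom hne hS
    obtain rfl := hk.unique ha
    refine ⟨?_, fun b hb x => (hkx (f.toFun x)).2 ?_⟩
    · rintro _ ⟨g, hg, rfl⟩ x
      exact hk.1 hg (f.toFun x)
    · rintro _ ⟨g, hg, rfl⟩
      exact hb ⟨g, hg, rfl⟩ x
  scottContinuous_postcomp X {Y Z} g S hne hS a ha := by
    obtain ⟨k, hk, hkx⟩ := KS.exists_isLUB_hom hne hS
    obtain rfl := hk.unique ha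
    refine ⟨?_, fun b hb x => ?_⟩
    · rintro _ ⟨f, hf, rfl⟩ x
      exact g.scottContinuous.monotone (hk.1 hf x)
    · have hd : DirectedOn (· ≤ ·) ((fun f : X ⟶ Y => f.toFun x) '' S) := by
        rintro _ ⟨f, hf, rfl⟩ _ ⟨l, hl, rfl⟩
        obtain ⟨m, hm, hfm, hlm⟩ := hS f hf l hl
        exact ⟨_, ⟨m, hm, rfl⟩, hfm x, hlm x⟩
      refine (g.scottContinuous (hne.image _) hd (hkx x)).2 ?_
      rintro _ ⟨_, ⟨f, hf, rfl⟩, rfl⟩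
      exact hb ⟨f, hf, rfl⟩ x
  comp_bot _ _ := rfl
  bot_comp X {Y Z} g := KS.hom_ext fun _ => g.strict

/-- The order on morphisms of the opposite category: `f ≤ g` means `f.unop ≤ g.unop`. -/
@[reducible]
def opHomDcpo {C : Type u} [Category.{v} C] [DcpoCategory C] (X Y : Cᵒᵖ) :
    CompletePartialOrder (X ⟶ Y) :=
  { le := fun f g => f.unop ≤ g.unop
    le_refl := fun f => le_refl f.unop
    le_trans := fun _ _ _ h h' => le_trans (α := Y.unop ⟶ X.unop) h h'
    le_antisymm := fun _ _ h h' =>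
      Quiver.Hom.unop_inj (le_antisymm (α := Y.unop ⟶ X.unop) h h')
    sSup := fun S => (sSup {f : Y.unop ⟶ X.unop | f.op ∈ S}).op
    bot := (⊥ : Y.unop ⟶ X.unop).op
    bot_le := fun f => bot_le (a := f.unop)
    lubOfDirected := fun S hS => by
      have hS' : DirectedOn (· ≤ ·) {f : Y.unop ⟶ X.unop | f.op ∈ S} := fun f hf g hg => by
        obtain ⟨k, hk, h⟩ := hS f.op hf g.op hg
        exact ⟨k.unop, hk, h⟩
      have h := hS'.isLUB_sSup
      exact ⟨fun f hf => h.1 (show f.unop ∈ {f : Y.unop ⟶ X.unop | f.op ∈ S} from hf),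
        fun b hb => h.2 (show b.unop ∈ upperBounds {f : Y.unop ⟶ X.unop | f.op ∈ S} from
          fun f hf => hb (show f.op ∈ S from hf))⟩ }

/-- The opposite category, with the same order on morphisms. -/
instance (C : Type u) [Category.{v} C] [DcpoCategory C] : DcpoCategory Cᵒᵖ where
  homDcpo := opHomDcpo
  scottContinuous_precomp {X Y} f Z S hne hS a ha := by
    let _ := opHomDcpo (C := C)
    let S' : Set (Z.unop ⟶ Y.unop) := {k | k.op ∈ S}
    have hne' : S'.Nonempty := by
      obtain ⟨k, hk⟩ := hne
      exact ⟨k.unop, hk⟩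
    have hS' : DirectedOn (· ≤ ·) S' := fun k hk l hl => by
      obtain ⟨m, hm, h⟩ := hS k.op hk l.op hl
      exact ⟨m.unop, hm, h⟩
    have ha' : IsLUB S' a.unop :=
      ⟨fun k hk => ha.1 (show k.op ∈ S from hk), fun b hb =>
        ha.2 (show b.op ∈ upperBounds S from fun k hk => hb (show k.unop ∈ S' from hk))⟩
    have h := DcpoCategory.scottContinuous_postcomp Z.unop f.unop hne' hS' ha'
    refine ⟨?_, fun b hb => h.2 (show b.unop ∈ upperBounds _ from ?_)⟩
    · rintro _ ⟨k, hk, rfl⟩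
      exact h.1 ⟨k.unop, hk, rfl⟩
    · rintro _ ⟨k, hk, rfl⟩
      exact hb ⟨k.op, hk, rfl⟩
  scottContinuous_postcomp X {Y Z} g S hne hS a ha := by
    let _ := opHomDcpo (C := C)
    let S' : Set (Y.unop ⟶ X.unop) := {k | k.op ∈ S}
    have hne' : S'.Nonempty := by
      obtain ⟨k, hk⟩ := hne
      exact ⟨k.unop, hk⟩
    have hS' : DirectedOn (· ≤ ·) S' := fun k hk l hl => by
      obtain ⟨m, hm, h⟩ := hS k.op hk l.op hl
      exact ⟨m.unop, hm, h⟩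
    have ha' : IsLUB S' a.unop :=
      ⟨fun k hk => ha.1 (show k.op ∈ S from hk), fun b hb =>
        ha.2 (show b.op ∈ upperBounds S from fun k hk => hb (show k.unop ∈ S' from hk))⟩
    have h := DcpoCategory.scottContinuous_precomp g.unop X.unop hne' hS' ha'
    refine ⟨?_, fun b hb => h.2 (show b.unop ∈ upperBounds _ from ?_)⟩
    · rintro _ ⟨k, hk, rfl⟩
      exact h.1 ⟨k.unop, hk, rfl⟩
    · rintro _ ⟨k, hk, rfl⟩
      exact hb ⟨k.op, hk, rfl⟩
  comp_bot {X Y} f Z := congrArg Quiver.Hom.op (DcpoCategory.bot_comp Z.unop f.unop)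
  bot_comp X {Y Z} g := congrArg Quiver.Hom.op (DcpoCategory.comp_bot g.unop X.unop)

/-- The product of two pointed dcpos, with the componentwise order. -/
@[reducible]
def prodDcpo (α : Type u) (β : Type v) [CompletePartialOrder α] [CompletePartialOrder β] :
    CompletePartialOrder (α × β) :=
  { (inferInstance : PartialOrder (α × β)), (inferInstance : OrderBot (α × β)) with
    sSup := fun S => (sSup (Prod.fst '' S), sSup (Prod.snd '' S))
    lubOfDirected := fun _ hS => isLUB_prod.2 ⟨hS.fst.isLUB_sSup, hS.snd.isLUB_sSup⟩ }

/-- The product category, with the componentwise order on morphisms. -/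
instance (C : Type u) (D : Type w) [Category.{v} C] [Category.{v} D] [DcpoCategory C]
    [DcpoCategory D] : DcpoCategory (C × D) where
  homDcpo X Y := prodDcpo (X.1 ⟶ Y.1) (X.2 ⟶ Y.2)
  scottContinuous_precomp f Z :=
    ScottContinuous.prod (DcpoCategory.scottContinuous_precomp f.1 Z.1)
      (DcpoCategory.scottContinuous_precomp f.2 Z.2)
  scottContinuous_postcomp X _ _ g :=
    ScottContinuous.prod (DcpoCategory.scottContinuous_postcomp X.1 g.1)
      (DcpoCategory.scottContinuous_postcomp X.2 g.2)
  comp_bot f Z := Prod.ext (DcpoCategory.comp_bot f.1 Z.1) (DcpoCategory.comp_bot f.2 Z.2)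
  bot_comp X _ _ g := Prod.ext (DcpoCategory.bot_comp X.1 g.1) (DcpoCategory.bot_comp X.2 g.2)

/-! ### Locally continuous endofunctors and algebraic compactness -/

/-- A functor between `Dcpo_{⊥!}`-enriched categories is locally continuous if all its maps
`C(X, Y) → D(FX, FY)` are Scott-continuous. -/
def LocallyContinuous {C : Type u} {D : Type w} [Category.{v} C] [Category.{v} D]
    [DcpoCategory C] [DcpoCategory D] (F : C ⥤ D) : Prop :=
  ∀ X Y : C, ScottContinuous fun f : X ⟶ Y => F.map f

/-- `C` is algebraically compact for the class `L` of endofunctors: every `F` in `L` has a fixpoint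
`e : F μF ≅ μF` such that `(μF, e)` is an initial `F`-algebra and `(μF, e⁻¹)` is a final
`F`-coalgebra. -/
def AlgebraicallyCompactFor (C : Type u) [Category.{v} C] (L : Set (C ⥤ C)) : Prop :=
  ∀ F ∈ L, ∃ (μF : C) (e : F.obj μF ≅ μF),
    Nonempty (Limits.IsInitial (Endofunctor.Algebra.mk (F := F) μF e.hom)) ∧
    Nonempty (Limits.IsTerminal (Endofunctor.Coalgebra.mk (F := F) μF e.inv))

end Kegelspitzen

end

/-!
Let `F` be locally continuous and `D` the bilimit of `0 → F 0 → F² 0 → ⋯`, with its isomorphism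
`e : F D ≅ D`. The idempotents `D → Fⁿ 0 → D`, whose supremum is `𝟙 D`, lie below the Kleene
iterates of `f ↦ e⁻¹ ≫ F f ≫ e`, so `𝟙 D` is also the supremum of these iterates: `D` is a minimal
invariant. Composing with an algebra homomorphism out of `D`, or a coalgebra homomorphism into `D`,
turns these iterates into those for the other (co)algebra, so any such homomorphism is their
supremum; hence it is unique, and `D` is both initial and final.

Bilimits exist in `KS` because limits are computed pointwise and a limit of the projections of a
chain is a bilimit. Being self-dual and componentwise, bilimits pass to `KSᵒᵖ × KS`.
-/

noncomputable section

namespace Kegelspitzen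

section Order

variable {α β : Type*} [Preorder α] [Preorder β]

theorem isLUB_range_map {ι : Type*} [Preorder ι] [IsDirectedOrder ι] [Nonempty ι] {φ : α → β}
    (hφ : ScottContinuous φ) {f : ι → α} (hf : Monotone f) {a : α} (ha : IsLUB (Set.range f) a) :
    IsLUB (Set.range fun i => φ (f i)) (φ a) := by
  have h := hφ (Set.range_nonempty f) hf.directed_le.directedOn_range ha
  rwa [← Set.range_comp] at h

theorem isLUB_range_add_iff {f : ℕ → α} (hf : Monotone f) (k : ℕ) {a : α} :
    IsLUB (Set.range fun n => f (n + k)) a ↔ IsLUB (Set.range f) a := by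
  have h := hf.upperBounds_range_comp_tendsto_atTop (Filter.tendsto_add_atTop_nat k)
  exact iff_of_eq (congrArg (IsLeast · a) h)

end Order

section DcpoCategory

variable {C : Type u} [Category.{v} C] [DcpoCategory C]

theorem scottContinuous_comp (X Y Z : C) :
    ScottContinuous fun p : (X ⟶ Y) × (Y ⟶ Z) => p.1 ≫ p.2 :=
  ScottContinuous.fromProd (fun f => DcpoCategory.scottContinuous_precomp f Z)
    fun g => DcpoCategory.scottContinuous_postcomp X g

theorem comp_le_comp {X Y Z : C} {f f' : X ⟶ Y} {g g' : Y ⟶ Z} (hf : f ≤ f') (hg : g ≤ g') :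
    f ≫ g ≤ f' ≫ g' :=
  (scottContinuous_comp X Y Z).monotone (Prod.mk_le_mk.2 ⟨hf, hg⟩)

theorem comp_eq_bot_of_id_eq_bot {X Y Z : C} (hY : 𝟙 Y = ⊥) (f : X ⟶ Y) (g : Y ⟶ Z) :
    f ≫ g = ⊥ := by
  rw [← Category.id_comp g, hY, DcpoCategory.bot_comp, DcpoCategory.comp_bot]

theorem isLUB_range_comp {ι : Type*} [Preorder ι] [IsDirectedOrder ι] [Nonempty ι] {X Y Z : C}
    {f : ι → (X ⟶ Y)} {g : ι → (Y ⟶ Z)} {a : X ⟶ Y} {b : Y ⟶ Z} (hf : Monotone f)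
    (hg : Monotone g) (ha : IsLUB (Set.range f) a) (hb : IsLUB (Set.range g) b) :
    IsLUB (Set.range fun i => f i ≫ g i) (a ≫ b) := by
  refine isLUB_range_map (scottContinuous_comp X Y Z) (hf.prodMk hg) (a := (a, b))
    (isLUB_prod.2 ?_)
  rw [← Set.range_comp, ← Set.range_comp]
  exact ⟨ha, hb⟩

end DcpoCategory

/-! ### Minimal invariants -/

section MinimalInvariant

variable {C : Type u} [Category.{v} C] [DcpoCategory C] {F : C ⥤ C}

/-- The Kleene iterates, starting from `⊥`, of the operator `f ↦ V.str ≫ F f ≫ A.str`, whose fixed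
points are the coalgebra-to-algebra morphisms (hylomorphisms) from `V` to `A`. -/
def hyloApprox (V : Endofunctor.Coalgebra F) (A : Endofunctor.Algebra F) : ℕ → (V.V ⟶ A.a)
  | 0 => ⊥
  | n + 1 => V.str ≫ F.map (hyloApprox V A n) ≫ A.str

/-- An isomorphism `e : F D ≅ D` is a minimal invariant of `F` if the identity of `D` is the least
fixed point of `f ↦ e.inv ≫ F f ≫ e.hom`, stated here as the supremum of the Kleene iterates. -/
def IsMinimalInvariant {D : C} (e : F.obj D ≅ D) : Prop :=
  IsLUB (Set.range (hyloApprox ⟨D, e.inv⟩ ⟨D, e.hom⟩)) (𝟙 D)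

theorem hyloApprox_comp (V : Endofunctor.Coalgebra F) {A A' : Endofunctor.Algebra F}
    (g : A ⟶ A') (n : ℕ) : hyloApprox V A n ≫ g.f = hyloApprox V A' n := by
  induction n with
  | zero => exact DcpoCategory.bot_comp _ g.f
  | succ n ih =>
    simp only [hyloApprox, Category.assoc, ← ih, F.map_comp, g.h]

theorem comp_hyloApprox {V V' : Endofunctor.Coalgebra F} (g : V' ⟶ V)
    (A : Endofunctor.Algebra F) (n : ℕ) : g.f ≫ hyloApprox V A n = hyloApprox V' A n := by
  induction n with
  | zero => exact DcpoCategory.comp_bot g.f _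
  | succ n ih =>
    simp only [hyloApprox, ← ih, F.map_comp, Category.assoc, ← g.h_assoc]

variable (hF : LocallyContinuous F)
include hF

theorem hyloApprox_le {V : Endofunctor.Coalgebra F} {A : Endofunctor.Algebra F} {h : V.V ⟶ A.a}
    (hh : V.str ≫ F.map h ≫ A.str ≤ h) (n : ℕ) : hyloApprox V A n ≤ h := by
  induction n with
  | zero => exact bot_le
  | succ n ih =>
    exact (comp_le_comp le_rfl (comp_le_comp ((hF _ _).monotone ih) le_rfl)).trans hh

theorem monotone_hyloApprox (V : Endofunctor.Coalgebra F) (A : Endofunctor.Algebra F) :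
    Monotone (hyloApprox V A) := by
  refine monotone_nat_of_le_succ fun n => ?_
  induction n with
  | zero => exact bot_le
  | succ n ih => exact comp_le_comp le_rfl (comp_le_comp ((hF _ _).monotone ih) le_rfl)

theorem exists_hylo (V : Endofunctor.Coalgebra F) (A : Endofunctor.Algebra F) :
    ∃ h : V.V ⟶ A.a, V.str ≫ F.map h ≫ A.str = h := by
  have hmono := monotone_hyloApprox hF V A
  have hlub := hmono.directed_le.directedOn_range.isLUB_sSup
  have hstep : ScottContinuous fun f : V.V ⟶ A.a => V.str ≫ F.map f ≫ A.str :=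
    ((hF _ _).comp (DcpoCategory.scottContinuous_postcomp _ A.str)).comp
      (DcpoCategory.scottContinuous_precomp V.str _)
  exact ⟨_, (isLUB_range_map hstep hmono hlub).unique ((isLUB_range_add_iff hmono 1).2 hlub)⟩

variable {D : C} {e : F.obj D ≅ D}

theorem IsMinimalInvariant.isLUB_of_algebraHom (he : IsMinimalInvariant e)
    {A : Endofunctor.Algebra F} (g : Endofunctor.Algebra.mk D e.hom ⟶ A) :
    IsLUB (Set.range (hyloApprox ⟨D, e.inv⟩ A)) g.f := by
  have h := isLUB_range_map (DcpoCategory.scottContinuous_postcomp D g.f)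
    (monotone_hyloApprox hF _ _) he
  simpa only [hyloApprox_comp, Category.id_comp] using h

theorem IsMinimalInvariant.isLUB_of_coalgebraHom (he : IsMinimalInvariant e)
    {V : Endofunctor.Coalgebra F} (g : V ⟶ Endofunctor.Coalgebra.mk D e.inv) :
    IsLUB (Set.range (hyloApprox V ⟨D, e.hom⟩)) g.f := by
  have h := isLUB_range_map (DcpoCategory.scottContinuous_precomp g.f D)
    (monotone_hyloApprox hF _ _) he
  simpa only [comp_hyloApprox, Category.comp_id] using h

theorem IsMinimalInvariant.nonempty_isInitial (he : IsMinimalInvariant e) :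
    Nonempty (Limits.IsInitial (Endofunctor.Algebra.mk D e.hom)) := by
  choose h hh using exists_hylo hF ⟨D, e.inv⟩
  refine ⟨.ofUniqueHom (fun A => ⟨h A, e.inv_comp_eq.1 (hh A)⟩) fun A g => ?_⟩
  exact Endofunctor.Algebra.Hom.ext
    ((he.isLUB_of_algebraHom hF g).unique (he.isLUB_of_algebraHom hF _))

theorem IsMinimalInvariant.nonempty_isTerminal (he : IsMinimalInvariant e) :
    Nonempty (Limits.IsTerminal (Endofunctor.Coalgebra.mk D e.inv)) := by
  choose h hh using fun V => exists_hylo hF V ⟨D, e.hom⟩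
  refine ⟨.ofUniqueHom (fun V => ⟨h V, ?_⟩) fun V g => ?_⟩
  · rw [Iso.eq_comp_inv, Category.assoc, hh]
  · exact Endofunctor.Coalgebra.Hom.ext
      ((he.isLUB_of_coalgebraHom hF g).unique (he.isLUB_of_coalgebraHom hF _))

end MinimalInvariant

/-! ### Bilimits of chains of embedding-projection pairs -/

section Bilimit

variable {C : Type u} [Category.{v} C] [DcpoCategory C]

/-- An embedding-projection pair from `X` to `Y`. -/
structure EPPair (X Y : C) where
  emb : X ⟶ Y
  proj : Y ⟶ X
  emb_proj : emb ≫ proj = 𝟙 X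
  proj_emb_le : proj ≫ emb ≤ 𝟙 Y

namespace EPPair

variable {X Y : C}

/-- The embedding-projection pair from an object `X` with `𝟙 X = ⊥`, that is, from a zero object. -/
def ofIdEqBot (hX : 𝟙 X = ⊥) (Y : C) : EPPair X Y where
  emb := ⊥
  proj := ⊥
  emb_proj := (DcpoCategory.bot_comp X _).trans hX.symm
  proj_emb_le := (DcpoCategory.bot_comp Y _).trans_le bot_le

/-- The image of an embedding-projection pair under a locally continuous functor. -/
def map {D : Type w} [Category.{v} D] [DcpoCategory D] (p : EPPair X Y) {F : C ⥤ D}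
    (hF : LocallyContinuous F) : EPPair (F.obj X) (F.obj Y) where
  emb := F.map p.emb
  proj := F.map p.proj
  emb_proj := by rw [← F.map_comp, p.emb_proj, F.map_id]
  proj_emb_le := by
    rw [← F.map_comp, ← F.map_id]
    exact (hF Y Y).monotone p.proj_emb_le

/-- An embedding-projection pair in the opposite category, with embedding and projection
exchanged. -/
def unop {X Y : Cᵒᵖ} (p : EPPair X Y) : EPPair X.unop Y.unop where
  emb := p.proj.unop
  proj := p.emb.unop
  emb_proj := congrArg Quiver.Hom.unop p.emb_proj
  proj_emb_le := p.proj_emb_le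

end EPPair

variable (C) in
/-- A sequence `X₀ → X₁ → X₂ → ⋯` of embedding-projection pairs. -/
structure EPChain where
  obj : ℕ → C
  pair (n : ℕ) : EPPair (obj n) (obj (n + 1))

namespace EPChain

/-- The chain without its first object. -/
abbrev shift (X : EPChain C) : EPChain C where
  obj n := X.obj (n + 1)
  pair n := X.pair (n + 1)

/-- The image of a chain under a locally continuous functor. -/
abbrev map {D : Type w} [Category.{v} D] [DcpoCategory D] (X : EPChain C) {F : C ⥤ D}
    (hF : LocallyContinuous F) : EPChain D where
  obj n := F.obj (X.obj n)
  pair n := (X.pair n).map hF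

/-- A chain in the opposite category, with embeddings and projections exchanged. -/
abbrev unop (X : EPChain Cᵒᵖ) : EPChain C where
  obj n := (X.obj n).unop
  pair n := (X.pair n).unop

end EPChain

/-- A bilimit of a chain `X` of embedding-projection pairs: an object `pt` containing every `X n` by
an embedding-projection pair `(ι n, π n)`, compatibly, such that the identity of `pt` is the
supremum of the idempotents `π n ≫ ι n`. -/
structure Bilimit (X : EPChain C) where
  pt : C
  ι (n : ℕ) : X.obj n ⟶ pt
  π (n : ℕ) : pt ⟶ X.obj n
  emb_ι (n : ℕ) : (X.pair n).emb ≫ ι (n + 1) = ι n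
  π_proj (n : ℕ) : π (n + 1) ≫ (X.pair n).proj = π n
  ι_π (n : ℕ) : ι n ≫ π n = 𝟙 (X.obj n)
  isLUB_π_ι : IsLUB (Set.range fun n => π n ≫ ι n) (𝟙 pt)

namespace Bilimit

variable {X : EPChain C}

theorem monotone_π_ι (B B' : Bilimit X) : Monotone fun n => B.π n ≫ B'.ι n := by
  refine monotone_nat_of_le_succ fun n => ?_
  calc B.π n ≫ B'.ι n
      = B.π (n + 1) ≫ ((X.pair n).proj ≫ (X.pair n).emb) ≫ B'.ι (n + 1) := by
        rw [← B.π_proj, ← B'.emb_ι, Category.assoc, Category.assoc]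
    _ ≤ B.π (n + 1) ≫ 𝟙 _ ≫ B'.ι (n + 1) :=
        comp_le_comp le_rfl (comp_le_comp (X.pair n).proj_emb_le le_rfl)
    _ = B.π (n + 1) ≫ B'.ι (n + 1) := by rw [Category.id_comp]

/-- The comparison morphism between two bilimits of a chain, the supremum of the morphisms
`B.π n ≫ B'.ι n`. -/
def comparison (B B' : Bilimit X) : B.pt ⟶ B'.pt :=
  sSup (Set.range fun n => B.π n ≫ B'.ι n)

theorem isLUB_comparison (B B' : Bilimit X) :
    IsLUB (Set.range fun n => B.π n ≫ B'.ι n) (comparison B B') :=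
  (monotone_π_ι B B').directed_le.directedOn_range.isLUB_sSup

theorem π_ι_le_comparison (B B' : Bilimit X) (n : ℕ) : B.π n ≫ B'.ι n ≤ comparison B B' :=
  (isLUB_comparison B B').1 ⟨n, rfl⟩

theorem comparison_self (B : Bilimit X) : comparison B B = 𝟙 B.pt :=
  (isLUB_comparison B B).unique B.isLUB_π_ι

theorem comparison_comp (B B' B'' : Bilimit X) :
    comparison B B' ≫ comparison B' B'' = comparison B B'' := by
  have h := isLUB_range_comp (monotone_π_ι B B') (monotone_π_ι B' B'') (isLUB_comparison B B')
    (isLUB_comparison B' B'')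
  have hn (n : ℕ) : (B.π n ≫ B'.ι n) ≫ B'.π n ≫ B''.ι n = B.π n ≫ B''.ι n := by
    rw [Category.assoc, reassoc_of% B'.ι_π n]
  simp only [hn] at h
  exact h.unique (isLUB_comparison B B'')

/-- Bilimits of a chain are unique up to isomorphism. -/
def iso (B B' : Bilimit X) : B.pt ≅ B'.pt where
  hom := comparison B B'
  inv := comparison B' B
  hom_inv_id := (comparison_comp B B' B).trans (comparison_self B)
  inv_hom_id := (comparison_comp B' B B').trans (comparison_self B')

/-- A bilimit of a chain is a bilimit of the chain without its first object. -/
abbrev shift (B : Bilimit X) : Bilimit X.shift where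
  pt := B.pt
  ι n := B.ι (n + 1)
  π n := B.π (n + 1)
  emb_ι n := B.emb_ι (n + 1)
  π_proj n := B.π_proj (n + 1)
  ι_π n := B.ι_π (n + 1)
  isLUB_π_ι := (isLUB_range_add_iff (monotone_π_ι B B) 1).2 B.isLUB_π_ι

/-- Locally continuous functors preserve bilimits. -/
abbrev map {D : Type w} [Category.{v} D] [DcpoCategory D] (B : Bilimit X) {F : C ⥤ D}
    (hF : LocallyContinuous F) : Bilimit (X.map hF) where
  pt := F.obj B.pt
  ι n := F.map (B.ι n)
  π n := F.map (B.π n)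
  emb_ι n := (F.map_comp _ _).symm.trans (congrArg F.map (B.emb_ι n))
  π_proj n := (F.map_comp _ _).symm.trans (congrArg F.map (B.π_proj n))
  ι_π n := by rw [← F.map_comp, B.ι_π, F.map_id]
  isLUB_π_ι := by
    have h := isLUB_range_map (hF _ _) (monotone_π_ι B B) B.isLUB_π_ι
    simp only [F.map_comp, F.map_id] at h
    exact h

/-- A bilimit of `X.unop`, seen in the opposite category with injections and projections
exchanged. -/
def ofUnop {X : EPChain Cᵒᵖ} (B : Bilimit X.unop) : Bilimit X where
  pt := op B.pt
  ι n := (B.π n).op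
  π n := (B.ι n).op
  emb_ι n := congrArg Quiver.Hom.op (B.π_proj n)
  π_proj n := congrArg Quiver.Hom.op (B.emb_ι n)
  ι_π n := congrArg Quiver.Hom.op (B.ι_π n)
  isLUB_π_ι := by
    refine ⟨?_, fun b hb => B.isLUB_π_ι.2 (show b.unop ∈ upperBounds _ from ?_)⟩
    · rintro _ ⟨n, rfl⟩
      exact B.isLUB_π_ι.1 ⟨n, rfl⟩
    · rintro _ ⟨n, rfl⟩
      exact hb ⟨n, rfl⟩

end Bilimit

variable {D : Type w} [Category.{v} D] [DcpoCategory D]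

theorem locallyContinuous_fst : LocallyContinuous (CategoryTheory.Prod.fst C D) :=
  fun _ _ => ScottContinuous.fst

theorem locallyContinuous_snd : LocallyContinuous (CategoryTheory.Prod.snd C D) :=
  fun _ _ => ScottContinuous.snd

/-- Bilimits in a product category are computed componentwise. -/
def Bilimit.prod {X : EPChain (C × D)} (B : Bilimit (X.map locallyContinuous_fst))
    (B' : Bilimit (X.map locallyContinuous_snd)) : Bilimit X where
  pt := (B.pt, B'.pt)
  ι n := (B.ι n, B'.ι n)
  π n := (B.π n, B'.π n)
  emb_ι n := Prod.ext (B.emb_ι n) (B'.emb_ι n)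
  π_proj n := Prod.ext (B.π_proj n) (B'.π_proj n)
  ι_π n := Prod.ext (B.ι_π n) (B'.ι_π n)
  isLUB_π_ι := by
    refine isLUB_prod.2 ⟨?_, ?_⟩ <;> rw [← Set.range_comp]
    exacts [B.isLUB_π_ι, B'.isLUB_π_ι]

end Bilimit

section Iterate

variable {C : Type u} [Category.{v} C] [DcpoCategory C]

/-- The chain `Z → F Z → F (F Z) → ⋯` of iterates of `F` at a zero object `Z`. -/
abbrev iterChain {F : C ⥤ C} (hF : LocallyContinuous F) {Z : C} (hZ : 𝟙 Z = ⊥) : EPChain C where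
  obj := Nat.rec Z fun _ => F.obj
  pair := Nat.rec (.ofIdEqBot hZ _) fun _ p => p.map hF

theorem isMinimalInvariant_iso_map_shift {F : C ⥤ C} (hF : LocallyContinuous F) {Z : C}
    (hZ : 𝟙 Z = ⊥) (B : Bilimit (iterChain hF hZ)) :
    IsMinimalInvariant ((B.map hF).iso B.shift) := by
  set e : F.obj B.pt ≅ B.pt := (B.map hF).iso B.shift
  have h_inv (n : ℕ) : B.π (n + 1) ≫ F.map (B.ι n) ≤ e.inv :=
    Bilimit.π_ι_le_comparison B.shift (B.map hF) n
  have h_hom (n : ℕ) : F.map (B.π n) ≫ B.ι (n + 1) ≤ e.hom :=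
    Bilimit.π_ι_le_comparison (B.map hF) B.shift n
  have le_approx (n : ℕ) : B.π n ≫ B.ι n ≤ hyloApprox ⟨B.pt, e.inv⟩ ⟨B.pt, e.hom⟩ n := by
    induction n with
    | zero => exact (comp_eq_bot_of_id_eq_bot hZ (B.π 0) (B.ι 0)).le
    | succ n ih =>
      calc B.π (n + 1) ≫ B.ι (n + 1)
          = (B.π (n + 1) ≫ F.map (B.ι n)) ≫ F.map (B.π n ≫ B.ι n) ≫
              F.map (B.π n) ≫ B.ι (n + 1) := by
            simp only [F.map_comp, Category.assoc, reassoc_of% (B.map hF).ι_π n]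
        _ ≤ e.inv ≫ F.map (hyloApprox ⟨B.pt, e.inv⟩ ⟨B.pt, e.hom⟩ n) ≫ e.hom :=
            comp_le_comp (h_inv n) (comp_le_comp ((hF _ _).monotone ih) (h_hom n))
  have approx_le := hyloApprox_le hF (V := ⟨B.pt, e.inv⟩) (A := ⟨B.pt, e.hom⟩) (h := 𝟙 B.pt)
    (by simp)
  refine ⟨Set.forall_mem_range.2 approx_le, fun f hf => B.isLUB_π_ι.2 ?_⟩
  exact Set.forall_mem_range.2 fun n => (le_approx n).trans (hf ⟨n, rfl⟩)

end Iterate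

/-- A `Dcpo_{⊥!}`-enriched category with a zero object, that is, an object whose identity is `⊥`,
and bilimits of all chains of embedding-projection pairs. -/
class HasBilimits (C : Type u) [Category.{v} C] [DcpoCategory C] : Prop where
  exists_id_eq_bot : ∃ Z : C, 𝟙 Z = ⊥
  nonempty_bilimit (X : EPChain C) : Nonempty (Bilimit X)

instance (C : Type u) [Category.{v} C] [DcpoCategory C] [HasBilimits C] : HasBilimits Cᵒᵖ where
  exists_id_eq_bot :=
    let ⟨Z, hZ⟩ := HasBilimits.exists_id_eq_bot (C := C)
    ⟨op Z, congrArg Quiver.Hom.op hZ⟩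
  nonempty_bilimit X := (HasBilimits.nonempty_bilimit X.unop).map .ofUnop

instance (C : Type u) (D : Type w) [Category.{v} C] [Category.{v} D] [DcpoCategory C]
    [DcpoCategory D] [HasBilimits C] [HasBilimits D] : HasBilimits (C × D) where
  exists_id_eq_bot :=
    let ⟨Z, hZ⟩ := HasBilimits.exists_id_eq_bot (C := C)
    let ⟨Z', hZ'⟩ := HasBilimits.exists_id_eq_bot (C := D)
    ⟨(Z, Z'), Prod.ext hZ hZ'⟩
  nonempty_bilimit X :=
    (HasBilimits.nonempty_bilimit (X.map locallyContinuous_fst)).map2 .prod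
      (HasBilimits.nonempty_bilimit (X.map locallyContinuous_snd))

theorem algebraicallyCompactFor_locallyContinuous (C : Type u) [Category.{v} C] [DcpoCategory C]
    [HasBilimits C] : AlgebraicallyCompactFor C {F | LocallyContinuous F} := by
  intro F hF
  obtain ⟨Z, hZ⟩ := HasBilimits.exists_id_eq_bot (C := C)
  obtain ⟨B⟩ := HasBilimits.nonempty_bilimit (iterChain hF hZ)
  have he := isMinimalInvariant_iso_map_shift hF hZ B
  exact ⟨_, _, he.nonempty_isInitial hF, he.nonempty_isTerminal hF⟩

/-! ### The limit–colimit coincidence -/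

namespace EPChain

variable {C : Type u} [Category.{v} C] [DcpoCategory C]

/-- The composite projection `X n ⟶ X 0`. -/
def toZero (X : EPChain C) : ∀ n, X.obj n ⟶ X.obj 0
  | 0 => 𝟙 _
  | n + 1 => (X.pair n).proj ≫ X.toZero n

/-- The composite of embeddings (if `n ≤ m`) or of projections (if `m ≤ n`) from `X n` to `X m`,
defined by recursion on both indices through `shift` so that no casts between objects occur. -/
def trans (X : EPChain C) : ∀ n m, X.obj n ⟶ X.obj m
  | n, 0 => X.toZero n
  | 0, m + 1 => X.trans 0 m ≫ (X.pair m).emb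
  | n + 1, m + 1 => X.shift.trans n m

theorem toZero_shift_proj (X : EPChain C) (n : ℕ) :
    X.shift.toZero n ≫ (X.pair 0).proj = X.toZero (n + 1) := by
  induction n with
  | zero => exact (Category.id_comp _).trans (Category.comp_id _).symm
  | succ n ih => exact (Category.assoc _ _ _).trans (congrArg ((X.pair (n + 1)).proj ≫ ·) ih)

theorem emb_trans_shift_zero (X : EPChain C) (m : ℕ) :
    (X.pair 0).emb ≫ X.shift.trans 0 m = X.trans 0 m ≫ (X.pair m).emb := by
  induction m with
  | zero => exact (Category.comp_id _).trans (Category.id_comp _).symm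
  | succ m ih =>
    exact (Category.assoc _ _ _).symm.trans (congrArg (· ≫ (X.pair (m + 1)).emb) ih)

theorem trans_self (X : EPChain C) (n : ℕ) : X.trans n n = 𝟙 (X.obj n) := by
  induction n generalizing X with
  | zero => rfl
  | succ _ ih => exact ih X.shift

theorem trans_proj (X : EPChain C) (n m : ℕ) :
    X.trans n (m + 1) ≫ (X.pair m).proj = X.trans n m := by
  induction m generalizing X n with
  | zero =>
    cases n with
    | zero => simp only [trans, Category.assoc, EPPair.emb_proj, Category.comp_id]
    | succ n => exact X.toZero_shift_proj n
  | succ m ih =>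
    cases n with
    | zero => simp only [trans, Category.assoc, EPPair.emb_proj, Category.comp_id]
    | succ n => exact ih X.shift n

theorem emb_trans (X : EPChain C) (n m : ℕ) :
    (X.pair n).emb ≫ X.trans (n + 1) m = X.trans n m := by
  induction n generalizing X m with
  | zero =>
    cases m with
    | zero => simp only [trans, toZero, reassoc_of% (X.pair 0).emb_proj]
    | succ m => exact X.emb_trans_shift_zero m
  | succ n ih =>
    cases m with
    | zero => simp only [trans, toZero, reassoc_of% (X.pair (n + 1)).emb_proj]
    | succ m => exact ih X.shift m

theorem comp_toZero (X : EPChain C) {Y : C} {p : ∀ n, Y ⟶ X.obj n}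
    (hp : ∀ n, p (n + 1) ≫ (X.pair n).proj = p n) (n : ℕ) : p n ≫ X.toZero n = p 0 := by
  induction n with
  | zero => exact Category.comp_id _
  | succ n ih => rw [toZero, reassoc_of% hp n, ih]

theorem comp_trans_le (X : EPChain C) {Y : C} {p : ∀ n, Y ⟶ X.obj n}
    (hp : ∀ n, p (n + 1) ≫ (X.pair n).proj = p n) (n m : ℕ) : p n ≫ X.trans n m ≤ p m := by
  induction m generalizing X n with
  | zero => rw [trans]; exact (X.comp_toZero hp n).le
  | succ m ih =>
    cases n with
    | zero =>
      calc p 0 ≫ X.trans 0 m ≫ (X.pair m).emb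
          ≤ p m ≫ (X.pair m).emb := by
            rw [← Category.assoc]
            exact comp_le_comp (ih X hp 0) le_rfl
        _ = p (m + 1) ≫ (X.pair m).proj ≫ (X.pair m).emb := by rw [← hp m, Category.assoc]
        _ ≤ p (m + 1) ≫ 𝟙 _ := comp_le_comp le_rfl (X.pair m).proj_emb_le
        _ = p (m + 1) := Category.comp_id _
    | succ n => exact ih X.shift (p := fun n => p (n + 1)) (fun n => hp (n + 1)) n

/-- The projections of a chain, as a diagram of shape `ℕᵒᵖ`. -/
def projFunctor (X : EPChain C) : ℕᵒᵖ ⥤ C :=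
  Functor.ofOpSequence fun n => (X.pair n).proj

theorem cone_π_proj (X : EPChain C) (c : Limits.Cone X.projFunctor) (n : ℕ) :
    c.π.app (op (n + 1)) ≫ (X.pair n).proj = c.π.app (op n) := by
  rw [← c.w (homOfLE (n.le_add_right 1)).op]
  exact congrArg _ (Functor.ofOpSequence_map_homOfLE_succ (fun n => (X.pair n).proj) n).symm

/-- The cone formed by the canonical morphisms from `X n`. -/
def transCone (X : EPChain C) (n : ℕ) : Limits.Cone X.projFunctor where
  pt := X.obj n
  π := NatTrans.ofOpSequence (X.trans n) fun m => by
    have h := Functor.ofOpSequence_map_homOfLE_succ (fun n => (X.pair n).proj) m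
    exact (Category.id_comp _).trans ((X.trans_proj n m).symm.trans (congrArg _ h.symm))

end EPChain

/-- The limit–colimit coincidence: order-reflecting projections `π n`, compatible with those of the
chain, belong to a bilimit as soon as the canonical morphisms `X.trans n m` factor through them. -/
def Bilimit.ofProj {C : Type u} [Category.{v} C] [DcpoCategory C] {X : EPChain C} {L : C}
    (π : ∀ n, L ⟶ X.obj n) (π_proj : ∀ n, π (n + 1) ≫ (X.pair n).proj = π n)
    (le_of_π : ∀ {Y : C} {f g : Y ⟶ L}, (∀ n, f ≫ π n ≤ g ≫ π n) → f ≤ g)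
    (ι : ∀ n, X.obj n ⟶ L) (ι_π : ∀ n m, ι n ≫ π m = X.trans n m) : Bilimit X where
  pt := L
  ι := ι
  π := π
  emb_ι n := by
    have h (m : ℕ) : ((X.pair n).emb ≫ ι (n + 1)) ≫ π m = ι n ≫ π m := by
      rw [Category.assoc, ι_π, ι_π, X.emb_trans]
    exact le_antisymm (le_of_π fun m => (h m).le) (le_of_π fun m => (h m).ge)
  π_proj := π_proj
  ι_π n := (ι_π n n).trans (X.trans_self n)
  isLUB_π_ι := by
    refine ⟨Set.forall_mem_range.2 fun n => le_of_π fun m => ?_, fun f hf => le_of_π fun m => ?_⟩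
    · rw [Category.assoc, ι_π, Category.id_comp]
      exact X.comp_trans_le π_proj n m
    · calc 𝟙 L ≫ π m = (π m ≫ ι m) ≫ π m := by
            rw [Category.assoc, ι_π, X.trans_self, Category.comp_id, Category.id_comp]
        _ ≤ f ≫ π m := comp_le_comp (hf ⟨m, rfl⟩) le_rfl

/-! ### Limits of Kegelspitzen -/

section Pi

variable {α κ : Type*} {β : κ → Type*} [Preorder α] [∀ k, Preorder (β k)]

theorem scottContinuous_eval (k : κ) : ScottContinuous fun x : ∀ k, β k => x k :=
  fun _ _ _ _ ha => isLUB_pi.1 ha k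

theorem scottContinuous_pi {f : α → ∀ k, β k} (h : ∀ k, ScottContinuous fun a => f a k) :
    ScottContinuous f := by
  refine fun S hne hS a ha => isLUB_pi.2 fun k => ?_
  rw [Set.image_image]
  exact h k hne hS ha

end Pi

namespace KS

variable {J : Type w} [Category.{v} J] (F : J ⥤ KS.{max w u})

/-- The compatible families of elements of a diagram of Kegelspitzen, which form its limit with the
componentwise order and convex combinations. -/
@[ext]
structure LimitCarrier : Type (max w u) where
  val (j : J) : F.obj j
  map_val {i j : J} (f : i ⟶ j) : (F.map f).toFun (val i) = val j

namespace LimitCarrier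

variable {F}

instance : PartialOrder (LimitCarrier F) :=
  PartialOrder.lift val fun _ _ => LimitCarrier.ext

theorem le_iff {x y : LimitCarrier F} : x ≤ y ↔ ∀ j, x.val j ≤ y.val j := Iff.rfl

instance : OrderBot (LimitCarrier F) where
  bot := ⟨fun _ => ⊥, fun f => (F.map f).strict⟩
  bot_le _ := le_iff.2 fun _ => bot_le

theorem monotone_val (j : J) : Monotone fun x : LimitCarrier F => x.val j :=
  fun _ _ h => le_iff.1 h j

theorem isLUB_of_isLUB_val {S : Set (LimitCarrier F)} {a : LimitCarrier F}
    (h : ∀ j, IsLUB ((fun x : LimitCarrier F => x.val j) '' S) (a.val j)) : IsLUB S a :=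
  ⟨fun _ hx j => (h j).1 ⟨_, hx, rfl⟩,
    fun _ hb j => (h j).2 (Set.forall_mem_image.2 fun _ hx => le_iff.1 (hb hx) j)⟩

theorem exists_isLUB_val {S : Set (LimitCarrier F)} (hne : S.Nonempty)
    (hS : DirectedOn (· ≤ ·) S) : ∃ a : LimitCarrier F,
      ∀ j, IsLUB ((fun x : LimitCarrier F => x.val j) '' S) (a.val j) := by
  have hd (j : J) := hS.mono_comp (monotone_val j)
  have hl (j : J) := (hd j).isLUB_sSup
  refine ⟨⟨_, fun {i j} f => ?_⟩, hl⟩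
  have h := (F.map f).scottContinuous (hne.image _) (hd i) (hl i)
  simp only [Set.image_image, map_val] at h
  exact h.unique (hl j)

instance : CompletePartialOrder (LimitCarrier F) :=
  completePartialOrderOfExists _ fun _ hne hS =>
    (exists_isLUB_val hne hS).imp fun _ => isLUB_of_isLUB_val

theorem scottContinuous_val (j : J) : ScottContinuous fun x : LimitCarrier F => x.val j := by
  intro S hne hS a ha
  obtain ⟨b, hb⟩ := exists_isLUB_val hne hS
  obtain rfl := ha.unique (isLUB_of_isLUB_val hb)
  exact hb j

theorem scottContinuous_of_val {α : Type*} [Preorder α] {f : α → LimitCarrier F}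
    (h : ∀ j, ScottContinuous fun a => (f a).val j) : ScottContinuous f := by
  refine fun S hne hS a ha => isLUB_of_isLUB_val fun j => ?_
  rw [Set.image_image]
  exact h j hne hS ha

instance : ConvexSpace ℝ (LimitCarrier F) :=
  .mk (fun s => ⟨fun j => s.iConvexComb fun x => x.val j, fun f => by
      rw [(F.map f).affine.map_iConvexComb]
      exact congrArg s.iConvexComb (funext fun x => x.map_val f)⟩)
    (fun x => LimitCarrier.ext (by simp))
    (fun s => LimitCarrier.ext (by simp [iConvexComb_assoc]))

theorem isAffineMap_val (j : J) : IsAffineMap ℝ fun x : LimitCarrier F => x.val j :=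
  ⟨fun _ => rfl⟩

theorem isAffineMap_of_val {M : Type*} [ConvexSpace ℝ M] {f : M → LimitCarrier F}
    (h : ∀ j, IsAffineMap ℝ fun a => (f a).val j) : IsAffineMap ℝ f :=
  ⟨fun s => LimitCarrier.ext (funext fun j => ((h j).map_sConvexComb s).trans (by
    rw [(isAffineMap_val j).map_sConvexComb, StdSimplex.map_map]))⟩

theorem iConvexComb_val {I : Type*} (r : StdSimplex ℝ I) (x : I → LimitCarrier F) (j : J) :
    (r.iConvexComb x).val j = r.iConvexComb fun i => (x i).val j :=
  (isAffineMap_val j).map_iConvexComb r x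

theorem scale_val (r : unitInterval) (x : LimitCarrier F) (j : J) :
    (scale r x).val j = scale r (x.val j) :=
  (isAffineMap_val j).map_convexCombPair _ _ _ x ⊥

instance : IsKegelspitze (LimitCarrier F) where
  scottContinuous_iConvexComb n r := scottContinuous_of_val fun j => by
    simp only [iConvexComb_val]
    exact (scottContinuous_pi fun i => (scottContinuous_eval i).comp (scottContinuous_val j)).comp
      (IsKegelspitze.scottContinuous_iConvexComb n r)
  scottContinuous_scale_left x := scottContinuous_of_val fun j => by
    simp only [scale_val]
    exact IsKegelspitze.scottContinuous_scale_left (x.val j)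
  scottContinuous_scale_right r := scottContinuous_of_val fun j => by
    simp only [scale_val]
    exact (scottContinuous_val j).comp (IsKegelspitze.scottContinuous_scale_right r)

end LimitCarrier

/-- The limit cone of a diagram of Kegelspitzen, carried by the compatible families. -/
abbrev limitCone : Limits.Cone F where
  pt := ⟨LimitCarrier F⟩
  π :=
    { app j :=
        { toFun x := x.val j
          affine := LimitCarrier.isAffineMap_val j
          strict := rfl
          scottContinuous := LimitCarrier.scottContinuous_val j }
      naturality _ _ f := hom_ext fun x => (x.map_val f).symm }

theorem le_of_comp_limitCone_π_le {Y : KS.{max w u}} {f g : Y ⟶ (limitCone F).pt}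
    (h : ∀ j, f ≫ (limitCone F).π.app j ≤ g ≫ (limitCone F).π.app j) : f ≤ g :=
  fun x j => h j x

/-- The compatible families form the limit in the category of Kegelspitzen. -/
def isLimitLimitCone : Limits.IsLimit (limitCone F) where
  lift c :=
    { toFun y := ⟨fun j => (c.π.app j).toFun y, fun f =>
        congrArg (fun g => Hom.toFun g y) (c.w f)⟩
      affine := LimitCarrier.isAffineMap_of_val fun j => (c.π.app j).affine
      strict := LimitCarrier.ext (funext fun j => (c.π.app j).strict)
      scottContinuous := LimitCarrier.scottContinuous_of_val fun j => (c.π.app j).scottContinuous }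
  fac _ _ := rfl
  uniq _ _ h := hom_ext fun y => LimitCarrier.ext (funext fun j =>
    congrArg (fun g => Hom.toFun g y) (h j))

theorem exists_id_eq_bot : ∃ Z : KS.{u}, 𝟙 Z = ⊥ := by
  let F : Discrete PEmpty.{1} ⥤ KS.{u} := Functor.empty _
  exact ⟨_, le_bot_iff.1 (le_of_comp_limitCone_π_le F (f := 𝟙 _) fun j => j.as.elim)⟩

/-- The bilimit of a chain of Kegelspitzen, carried by the limit of the projections. -/
def bilimit (X : EPChain KS.{u}) : Bilimit X :=
  .ofProj (fun n => (limitCone.{u, 0, 0} X.projFunctor).π.app (op n)) (X.cone_π_proj _)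
    (fun h => le_of_comp_limitCone_π_le _ fun j => h j.unop)
    (fun n => (isLimitLimitCone.{u, 0, 0} X.projFunctor).lift (X.transCone n))
    (fun _ _ => rfl)

instance : HasBilimits KS.{u} where
  exists_id_eq_bot := exists_id_eq_bot
  nonempty_bilimit X := ⟨bilimit X⟩

end KS

end Kegelspitzen

end

theorem mainTheorem7 :
    Kegelspitzen.AlgebraicallyCompactFor (Kegelspitzen.KS.{u}ᵒᵖ × Kegelspitzen.KS.{u})
      {F | Kegelspitzen.LocallyContinuous F} :=
  Kegelspitzen.algebraicallyCompactFor_locallyContinuous _
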